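/- Let $k\ge 1$ and let $p\ge k+3$ be a prime. Let $\mathcal P_p$ be the set of integer partitions none of whose parts is divisible by $p$; for a partition $\lambda$ write $\ell(\lambda)$ for its number of parts and $n_\lambda$ for the product of its parts. For $\operatorname{Re}(s)>1$ put $$\zeta_{\mathcal P_p}(\{s\}^k)=\sum_{\lambda\in\mathcal P_p,\ \ell(\lambda)=k} n_\lambda^{-s}.$$ This series converges absolutely for $\operatorname{Re}(s)>1$ and continues holomorphically to $\mathbb C\setminus\{1,\tfrac12,\dots,\tfrac1k\}$; denote the continuation by the same symbol. Then there is a continuous function $f:\mathbb Z_p\to\mathbb Q_p$ that agrees with $\zeta_{\mathcal P_p}(\{s\}^k)$ on a positive proportion of the integers $s$. More precisely, for every natural number $m\equiv 2 \pmod{p-1}$, the value $\zeta_{\mathcal P_p}(\{1-m\}^k)$ is a rational number and equals $f(1-m)$; and the set of all integers $s$ such that $\zeta_{\mathcal P_p}(\{s\}^k)$ is rational and equals $f(s)$ has positive lower density in $\mathbb Z$. -/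

import Mathlib

namespace PartitionZeta

/-- The partitions of length `k` (of any size) none of whose parts is divisible by `p`. -/
def PartitionsPrimeTo (p k : ℕ) : Type :=
  {lam : Σ n : ℕ, n.Partition // lam.2.parts.card = k ∧ ∀ i ∈ lam.2.parts, ¬ p ∣ i}

/-- The product of the parts of a partition. -/
def PartitionsPrimeTo.norm {p k : ℕ} (lam : PartitionsPrimeTo p k) : ℕ :=
  lam.1.2.parts.prod

/-- `Z` is the length-`k` partition zeta function over partitions with no part divisible by `p`:
it is the (absolutely convergent) sum of `n_λ ^ (-s)` for `Re s > 1`, continued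
holomorphically to the connected open set `ℂ ∖ {1, 1/2, …, 1/k}`. By the identity theorem `Z` is
determined on that set, which contains every integer except `1`. -/
structure IsPartitionZeta (p k : ℕ) (Z : ℂ → ℂ) : Prop where
  hasSum : ∀ s : ℂ, 1 < s.re →
    HasSum (fun lam : PartitionsPrimeTo p k => (lam.norm : ℂ) ^ (-s)) (Z s)
  holomorphic : DifferentiableOn ℂ Z {s : ℂ | ∀ r ∈ Finset.Icc 1 k, (r : ℂ) * s ≠ 1}

/-- The complex-valued `Z` and the `p`-adic-valued `f` agree at the integer `s`: both values
are (the image of) one and the same rational number. -/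
def AgreeAt {p : ℕ} [Fact p.Prime] (Z : ℂ → ℂ) (f : ℤ_[p] → ℚ_[p]) (s : ℤ) : Prop :=
  ∃ q : ℚ, Z (s : ℂ) = (q : ℂ) ∧ f (s : ℤ_[p]) = (q : ℚ_[p])

/-- A set of integers of positive lower density. -/
def HasPositiveProportion (A : Set ℤ) : Prop :=
  ∃ c : ℝ, 0 < c ∧ ∀ᶠ N : ℕ in Filter.atTop,
    c * (2 * (N : ℝ) + 1) ≤ ((A ∩ Set.Icc (-(N : ℤ)) (N : ℤ)).ncard : ℝ)

end PartitionZeta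

/-! Summing over partitions of length `k` evaluates the complete homogeneous symmetric function at
the numbers `n ^ (-s)` with `p ∤ n`. Newton's identities (`hasSum_sym_prod`) write it as a rational
polynomial in the power sums `zetaPrimeTo p (i * s)`, `1 ≤ i ≤ k`. This gives the continuation,
which is unique by the identity theorem.

At `s = -(1 + (p - 1) t)` the power sums are `-bernoulliQuotient p e` with `e = i (1 + (p - 1) t)`.
Here `e + 1 ≡ i + 1 (mod p - 1)`, and `1 < i + 1 < p - 1` since `i ≤ k ≤ p - 3`. So Kummer's
congruences (`norm_bernoulliQuotient_sub_le`), proved through Voronoi sums, make each quotient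
`p`-adically continuous in `t`. The same polynomial in the interpolated quotients is `f`, and this
progression of `s` already has positive density. -/

namespace PartitionZeta

/-! ### Newton's identities for infinite families -/

/-- The complete homogeneous symmetric functions, expressed in the power sums `P` through
Newton's identity `k h_k = P_1 h_{k-1} + ⋯ + P_k h_0`. -/
noncomputable def completeHomogeneous {K : Type*} [Field K] (P : ℕ → K) : ℕ → K
  | 0 => 1
  | k + 1 => (∑ i : Fin (k + 1), P (i + 1) * completeHomogeneous P (k - i)) / ((k + 1 : ℕ) : K)
  termination_by k => k

theorem completeHomogeneous_zero {K : Type*} [Field K] (P : ℕ → K) :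
    completeHomogeneous P 0 = 1 := by
  rw [completeHomogeneous]

theorem completeHomogeneous_succ {K : Type*} [Field K] (P : ℕ → K) (k : ℕ) :
    completeHomogeneous P (k + 1) =
      (∑ i ∈ Finset.range (k + 1), P (i + 1) * completeHomogeneous P (k - i)) /
        ((k + 1 : ℕ) : K) := by
  rw [completeHomogeneous,
    Fin.sum_univ_eq_sum_range (fun i => P (i + 1) * completeHomogeneous P (k - i))]

theorem completeHomogeneous_congr {K : Type*} [Field K] {P Q : ℕ → K} {k : ℕ}
    (h : ∀ i, 1 ≤ i → i ≤ k → P i = Q i) :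
    completeHomogeneous P k = completeHomogeneous Q k := by
  induction k using Nat.strong_induction_on with
  | _ k ih =>
    cases k with
    | zero => simp only [completeHomogeneous_zero]
    | succ k =>
      simp only [completeHomogeneous_succ]
      congr 1
      refine Finset.sum_congr rfl fun i hi => ?_
      have hi := Finset.mem_range.mp hi
      rw [h (i + 1) (by omega) (by omega),
        ih (k - i) (by omega) fun j h1 h2 => h j h1 (by omega)]

theorem map_completeHomogeneous {K L : Type*} [Field K] [Field L] (φ : K →+* L) (P : ℕ → K)
    (k : ℕ) : φ (completeHomogeneous P k) = completeHomogeneous (fun i => φ (P i)) k := by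
  induction k using Nat.strong_induction_on with
  | _ k ih =>
    cases k with
    | zero => simp only [completeHomogeneous_zero, map_one]
    | succ k =>
      simp only [completeHomogeneous_succ, map_div₀, map_sum, map_mul, map_natCast]
      congr 1
      exact Finset.sum_congr rfl fun i _ => by rw [ih (k - i) (by omega)]

/-- Adjoining `i + 1` copies of `a` to a multiset of size `k - i`. -/
def consReplicate {α : Type*} (k i : ℕ) (hi : i ≤ k) (b : α × Sym α (k - i)) : Sym α (k + 1) :=
  ⟨Multiset.replicate (i + 1) b.1 + b.2.1, by
    have := b.2.2
    rw [Multiset.card_add, Multiset.card_replicate, this]; omega⟩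

/-- A point of the fiber is determined by its letter `a`, and `a` occurs exactly when `i + 1` copies
of it can be removed from `μ`. -/
theorem ncard_fiber_consReplicate {α : Type*} [DecidableEq α] (k i : ℕ) (hi : i ≤ k)
    (μ : Sym α (k + 1)) :
    (consReplicate k i hi ⁻¹' {μ}).ncard =
      (μ.1.toFinset.filter fun a => i < μ.1.count a).card := by
  have hinj : Set.InjOn (Prod.fst : α × Sym α (k - i) → α) (consReplicate k i hi ⁻¹' {μ}) := by
    rintro ⟨a, ν⟩ h ⟨b, ν'⟩ h' (rfl : a = b)
    have h : consReplicate k i hi (a, ν) = μ := h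
    have h' : consReplicate k i hi (a, ν') = μ := h'
    have := congrArg Subtype.val (h.trans h'.symm)
    exact Prod.ext rfl (Subtype.ext (add_left_cancel this))
  rw [← hinj.ncard_image, ← Set.ncard_coe_finset]
  congr 1
  ext a
  simp only [Set.mem_image, Set.mem_preimage, Set.mem_singleton_iff, Prod.exists,
    exists_and_right, exists_eq_right, Finset.coe_filter, Multiset.mem_toFinset, Set.mem_ofPred_eq]
  constructor
  · rintro ⟨ν, rfl⟩
    have : i < Multiset.count a (consReplicate k i hi (a, ν)).1 := by
      simp only [consReplicate, Multiset.count_add, Multiset.count_replicate_self]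
      omega
    exact ⟨Multiset.count_pos.mp (by omega), this⟩
  · rintro ⟨-, h⟩
    have hle : Multiset.replicate (i + 1) a ≤ μ.1 := Multiset.le_count_iff_replicate_le.mp h
    refine ⟨⟨μ.1 - Multiset.replicate (i + 1) a, ?_⟩, Subtype.ext ?_⟩
    · have := μ.2
      rw [Multiset.card_sub hle, Multiset.card_replicate, this]
      omega
    · exact add_tsub_cancel_of_le hle

/-- Each `a` is counted once for every `i` below its multiplicity. This is the factor `k` in
Newton's identity. -/
theorem sum_card_lt_count {α : Type*} [DecidableEq α] (k : ℕ) (μ : Multiset α)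
    (hμ : μ.card = k) :
    ∑ i ∈ Finset.range k, (μ.toFinset.filter fun a => i < μ.count a).card = k := by
  simp only [Finset.card_filter]
  rw [Finset.sum_comm]
  conv_rhs => rw [← hμ, ← Multiset.toFinset_sum_count_eq μ]
  refine Finset.sum_congr rfl fun a _ => ?_
  have hle := Multiset.count_le_card a μ
  rw [← Finset.card_filter]
  have : (Finset.range k).filter (fun i => i < μ.count a) = Finset.range (μ.count a) := by
    ext i
    simp only [Finset.mem_filter, Finset.mem_range]
    omega
  rw [this, Finset.card_range]

theorem hasSum_mul_complex {β γ : Type*} {f : β → ℂ} {g : γ → ℂ} {a b : ℂ} (hf : HasSum f a)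
    (hg : HasSum g b) : HasSum (fun x : β × γ => f x.1 * g x.2) (a * b) :=
  hf.mul hg (summable_mul_of_summable_norm (summable_norm_iff.mpr hf.summable)
    (summable_norm_iff.mpr hg.summable))

/-- The sum of the monomials of degree `k` in a summable family is given by Newton's identities
from the power sums of the family. -/
theorem hasSum_sym_prod {α : Type*} {x : α → ℂ} {P : ℕ → ℂ}
    (hP : ∀ i, 1 ≤ i → HasSum (fun a => x a ^ i) (P i)) (k : ℕ) :
    HasSum (fun μ : Sym α k => (μ.1.map x).prod) (completeHomogeneous P k) := by
  classical
  induction k using Nat.strong_induction_on with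
  | _ k ih =>
    cases k with
    | zero =>
      rw [completeHomogeneous_zero]
      convert hasSum_unique (fun μ : Sym α 0 => (μ.1.map x).prod) using 1
      rw [show (default : Sym α 0).1 = 0 from rfl, Multiset.map_zero, Multiset.prod_zero]
    | succ k =>
      have hterm : ∀ i ∈ Finset.range (k + 1), HasSum (fun μ : Sym α (k + 1) =>
          ((μ.1.toFinset.filter fun a => i < μ.1.count a).card : ℂ) * (μ.1.map x).prod)
          (P (i + 1) * completeHomogeneous P (k - i)) := by
        intro i hi
        have hik : i ≤ k := Nat.lt_succ_iff.mp (Finset.mem_range.mp hi)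
        have h1 := hP (i + 1) (by omega)
        have h2 := ih (k - i) (by omega)
        have h3 := hasSum_mul_complex h1 h2
        -- Grouping by the resulting multiset collects equal monomials, so the fiber size becomes
        -- the coefficient.
        have h4 := h3.tsum_fiberwise (consReplicate k i hik)
        refine Eq.mp (congrArg (HasSum · _) (funext fun μ => ?_)) h4
        have hconst : ∀ b : ↑(consReplicate k i hik ⁻¹' {μ}),
            x b.1.1 ^ (i + 1) * (b.1.2.1.map x).prod = (μ.1.map x).prod := by
          rintro ⟨b, rfl⟩
          simp only [consReplicate, Multiset.map_add, Multiset.prod_add, Multiset.map_replicate,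
            Multiset.prod_replicate]
        rw [tsum_congr hconst, tsum_const, Nat.card_coe_set_eq,
          ncard_fiber_consReplicate, nsmul_eq_mul]
      have hk : ((k + 1 : ℕ) : ℂ) ≠ 0 := Nat.cast_ne_zero.mpr (Nat.succ_ne_zero k)
      rw [completeHomogeneous_succ]
      refine Eq.mp (congrArg (HasSum · _) (funext fun μ => ?_))
        ((hasSum_sum hterm).div_const ((k + 1 : ℕ) : ℂ))
      rw [← Finset.sum_mul, ← Nat.cast_sum, sum_card_lt_count (k + 1) μ.1 μ.2,
        mul_div_cancel_left₀ _ hk]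

/-! ### The partition zeta function and its continuation -/

/-- The zeta function over the positive integers prime to `p`. -/
noncomputable def zetaPrimeTo (p : ℕ) (s : ℂ) : ℂ := (1 - (p : ℂ) ^ (-s)) * riemannZeta s

theorem hasSum_zetaPrimeTo {p : ℕ} (hp : p ≠ 0) {s : ℂ} (hs : 1 < s.re) :
    HasSum (fun n : ℕ => if p ∣ n then 0 else (n : ℂ) ^ (-s)) (zetaPrimeTo p s) := by
  have hall : HasSum (fun n : ℕ => (n : ℂ) ^ (-s)) (riemannZeta s) := by
    rw [zeta_eq_tsum_one_div_nat_cpow hs]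
    convert (Complex.summable_one_div_nat_cpow.mpr hs).hasSum using 2 with n
    rw [Complex.cpow_neg, one_div]
  have hmul : HasSum (fun n : ℕ => if p ∣ n then (n : ℂ) ^ (-s) else 0)
      ((p : ℂ) ^ (-s) * riemannZeta s) := by
    have hinj : Function.Injective (fun n : ℕ => p * n) :=
      fun a b h => Nat.eq_of_mul_eq_mul_left (Nat.pos_of_ne_zero hp) h
    rw [← hinj.hasSum_iff]
    · refine Eq.mp (congrArg (HasSum · _) (funext fun n => ?_)) (hall.mul_left ((p : ℂ) ^ (-s)))
      symm
      show (if p ∣ p * n then ((p * n : ℕ) : ℂ) ^ (-s) else 0) = _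
      rw [if_pos (dvd_mul_right p n), Nat.cast_mul, Complex.natCast_mul_natCast_cpow]
    · intro n hn
      exact if_neg fun ⟨m, hm⟩ => hn ⟨m, hm.symm⟩
  rw [zetaPrimeTo, sub_mul, one_mul]
  refine Eq.mp (congrArg (HasSum · _) (funext fun n => ?_)) (hall.sub hmul)
  split_ifs <;> simp

theorem differentiableAt_zetaPrimeTo {p : ℕ} (hp : p ≠ 0) {s : ℂ} (hs : s ≠ 1) :
    DifferentiableAt ℂ (zetaPrimeTo p) s := by
  refine DifferentiableAt.mul ?_ (differentiableAt_riemannZeta hs)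
  exact (differentiableAt_const _).sub
    (differentiableAt_id.neg.const_cpow (Or.inl (Nat.cast_ne_zero.mpr hp)))

/-- The length-`k` partition zeta function over parts prime to `p`, as a polynomial in
the functions `s ↦ zetaPrimeTo p (i * s)`. -/
noncomputable def partitionZeta (p k : ℕ) (s : ℂ) : ℂ :=
  completeHomogeneous (fun i => zetaPrimeTo p (i * s)) k

theorem natCast_multiset_prod_cpow (μ : Multiset ℕ) (s : ℂ) :
    ((μ.prod : ℕ) : ℂ) ^ s = (μ.map fun n : ℕ => (n : ℂ) ^ s).prod := by
  induction μ using Multiset.induction_on with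
  | empty => simp
  | cons a μ ih =>
    rw [Multiset.prod_cons, Multiset.map_cons, Multiset.prod_cons, Nat.cast_mul,
      Complex.natCast_mul_natCast_cpow, ih]

theorem isPartitionZeta_partitionZeta {p : ℕ} (hp : p ≠ 0) (k : ℕ) :
    IsPartitionZeta p k (partitionZeta p k) where
  hasSum s hs := by
    set x : ℕ → ℂ := fun n => if p ∣ n then 0 else (n : ℂ) ^ (-s) with hx
    have hP : ∀ i : ℕ, 1 ≤ i → HasSum (fun n => x n ^ i) (zetaPrimeTo p (i * s)) := by
      intro i hi
      have hi' : (1 : ℝ) ≤ i := by exact_mod_cast hi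
      convert hasSum_zetaPrimeTo hp (s := i * s) ?_ using 2 with n
      · simp only [hx]
        split_ifs
        · exact zero_pow (by omega)
        · rw [← mul_neg, Complex.cpow_nat_mul]
      · rw [Complex.mul_re, Complex.natCast_re, Complex.natCast_im, zero_mul, sub_zero]
        nlinarith
    have h := hasSum_sym_prod hP k
    let g : PartitionsPrimeTo p k → Sym ℕ k := fun lam => ⟨lam.1.2.parts, lam.2.1⟩
    have hg : Function.Injective g := by
      rintro ⟨⟨n, a⟩, ha⟩ ⟨⟨m, b⟩, hb⟩ hab
      have hab : a.parts = b.parts := congrArg Subtype.val hab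
      obtain rfl : n = m := by rw [← a.parts_sum, ← b.parts_sum, hab]
      obtain rfl : a = b := Nat.Partition.ext hab
      rfl
    rw [← hg.hasSum_iff] at h
    · refine Eq.mp (congrArg (HasSum · _) (funext fun lam => ?_)) h
      rw [PartitionsPrimeTo.norm, natCast_multiset_prod_cpow]
      exact congrArg Multiset.prod
        (Multiset.map_congr rfl fun n hn => if_neg (lam.2.2 n hn))
    -- A multiset not coming from such a partition has an entry divisible by `p` (possibly `0`), so
    -- its monomial vanishes.
    · intro μ hμ
      by_contra hne
      refine hμ ⟨⟨⟨μ.1.sum, ⟨μ.1, ?_, rfl⟩⟩, μ.2, ?_⟩, rfl⟩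
      all_goals
        intro n hn
        have hn' : ¬ p ∣ n := fun hd => hne <| Multiset.prod_eq_zero <|
          Multiset.mem_map.mpr ⟨n, hn, if_pos hd⟩
      · exact Nat.pos_of_ne_zero fun h0 => hn' (h0 ▸ dvd_zero p)
      · exact hn'
  holomorphic := by
    induction k using Nat.strong_induction_on with
    | _ k ih =>
      cases k with
      | zero =>
        have : partitionZeta p 0 = fun _ => 1 := funext fun s => completeHomogeneous_zero _
        rw [this]
        exact differentiableOn_const 1
      | succ k =>
        have : partitionZeta p (k + 1) = fun s => (∑ i ∈ Finset.range (k + 1),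
            zetaPrimeTo p ((i + 1 : ℕ) * s) * partitionZeta p (k - i) s) / ((k + 1 : ℕ) : ℂ) :=
          funext fun s => completeHomogeneous_succ _ k
        rw [this]
        refine DifferentiableOn.div_const (DifferentiableOn.fun_sum fun i hi => ?_) _
        have hi := Finset.mem_range.mp hi
        refine DifferentiableOn.mul (fun s hs => ?_) ((ih (k - i) (by omega)).mono ?_)
        · have h1 := hs (i + 1) (Finset.mem_Icc.mpr ⟨by omega, by omega⟩)
          exact ((differentiableAt_zetaPrimeTo hp h1).comp s
            (differentiableAt_id.const_mul _)).differentiableWithinAt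
        · intro s hs r hr
          have hr := Finset.mem_Icc.mp hr
          exact hs r (Finset.mem_Icc.mpr ⟨hr.1, by omega⟩)

/-- The complement of a finite set in `ℂ` is connected, and both functions equal the same series
near `2`. -/
theorem IsPartitionZeta.eqOn {p k : ℕ} {Z W : ℂ → ℂ} (hZ : IsPartitionZeta p k Z)
    (hW : IsPartitionZeta p k W) :
    Set.EqOn Z W {s : ℂ | ∀ r ∈ Finset.Icc 1 k, (r : ℂ) * s ≠ 1} := by
  set U := {s : ℂ | ∀ r ∈ Finset.Icc 1 k, (r : ℂ) * s ≠ 1} with hU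
  have hUc : U = ((Finset.Icc 1 k).image fun r : ℕ => (r : ℂ)⁻¹ : Set ℂ)ᶜ := by
    ext s
    simp only [hU, Set.mem_ofPred_eq, Set.mem_compl_iff, Finset.coe_image, Set.mem_image,
      Finset.mem_coe, not_exists, not_and]
    refine forall₂_congr fun r hr => not_congr ?_
    have hr0 : (r : ℂ) ≠ 0 := Nat.cast_ne_zero.mpr (by have := Finset.mem_Icc.mp hr; omega)
    rw [mul_comm, mul_eq_one_iff_eq_inv₀ hr0, eq_comm]
  have hopen : IsOpen U := by
    rw [hUc]
    exact (Set.toFinite _).isClosed.isOpen_compl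
  have hconn : IsPreconnected U := by
    rw [hUc]
    exact (Set.Countable.isConnected_compl_of_one_lt_rank
      (by rw [Complex.rank_real_complex]; norm_num) (Set.toFinite _).countable).isPreconnected
  have hre : ∀ᶠ s : ℂ in nhds 2, 1 < s.re :=
    Complex.continuous_re.continuousAt.eventually_const_lt (by norm_num)
  refine (hZ.holomorphic.analyticOnNhd hopen).eqOn_of_preconnected_of_eventuallyEq
    (hW.holomorphic.analyticOnNhd hopen) hconn (z₀ := 2) ?_
    (hre.mono fun s hs => (hZ.hasSum s hs).unique (hW.hasSum s hs))
  intro r hr h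
  have : ((r * 2 : ℕ) : ℂ) = (1 : ℕ) := by push_cast; exact h
  have := Nat.cast_injective this
  omega

end PartitionZeta

open Filter Topology

namespace PartitionZeta

/-! ### Voronoi sums and Bernoulli numbers -/

/-- The residues modulo `p ^ N` prime to `p`. -/
def residuesPrimeTo (p N : ℕ) : Finset ℕ := (Finset.range (p ^ N)).filter fun j => ¬ p ∣ j

/-- The Voronoi sums, whose `p`-adic limit is
`(c ^ (e + 1) - 1) * (1 - p ^ e) * bernoulli (e + 1) / (e + 1)`. -/
def voronoiSum (p c N e : ℕ) : ℕ :=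
  ∑ j ∈ residuesPrimeTo p N, (c * j / p ^ N) * (c * j) ^ e

/-- Multiplication by `c` permutes the units modulo `p ^ (N + 1)`. -/
theorem sum_residuesPrimeTo_mul_mod {p c : ℕ} (hp : p.Prime) (hc : ¬ p ∣ c) (N n : ℕ) :
    ∑ j ∈ residuesPrimeTo p (N + 1), (c * j % p ^ (N + 1)) ^ n =
      ∑ j ∈ residuesPrimeTo p (N + 1), j ^ n := by
  have hcop : (p ^ (N + 1)).Coprime c := Nat.Coprime.pow_left _ ((Nat.Prime.coprime_iff_not_dvd hp).mpr hc)
  have hM : 0 < p ^ (N + 1) := pow_pos hp.pos _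
  have hinj : Set.InjOn (fun j => c * j % p ^ (N + 1)) (residuesPrimeTo p (N + 1)) := by
    intro a ha b hb hab
    simp only [residuesPrimeTo, Finset.coe_filter, Finset.mem_range, Set.mem_ofPred_eq] at ha hb
    have h : a ≡ b [MOD p ^ (N + 1)] := Nat.ModEq.cancel_left_of_coprime hcop hab
    exact Nat.ModEq.eq_of_lt_of_lt h ha.1 hb.1
  have himg : (residuesPrimeTo p (N + 1)).image (fun j => c * j % p ^ (N + 1)) =
      residuesPrimeTo p (N + 1) := by
    refine Finset.eq_of_subset_of_card_le ?_ (Finset.card_image_of_injOn hinj).ge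
    intro r hr
    obtain ⟨j, hj, rfl⟩ := Finset.mem_image.mp hr
    simp only [residuesPrimeTo, Finset.mem_filter, Finset.mem_range] at hj ⊢
    refine ⟨Nat.mod_lt _ hM, fun hd => ?_⟩
    rw [Nat.dvd_mod_iff (dvd_pow_self p (Nat.succ_ne_zero N)), hp.dvd_mul] at hd
    exact hd.elim hc hj.2
  conv_rhs => rw [← himg, Finset.sum_image hinj]

/-- With `M = p ^ (N + 1)`, expand `(c j - M ⌊c j / M⌋) ^ (e + 1)` modulo `M ^ 2` and sum over `j`;
the permutation of residues identifies the left sides. -/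
theorem exists_voronoi {p c : ℕ} (hp : p.Prime) (hc : ¬ p ∣ c) (N e : ℕ) :
    ∃ K : ℤ, ((c : ℤ) ^ (e + 1) - 1) * ∑ j ∈ residuesPrimeTo p (N + 1), (j : ℤ) ^ (e + 1) =
      (e + 1) * p ^ (N + 1) * voronoiSum p c (N + 1) e + K * (p ^ (N + 1)) ^ 2 := by
  have hterm : ∀ j : ℕ, ∃ K : ℤ, ((c * j % p ^ (N + 1) : ℕ) : ℤ) ^ (e + 1) = (c * j : ℤ) ^ (e + 1)
      - (e + 1) * (c * j : ℤ) ^ e * (p ^ (N + 1) * (c * j / p ^ (N + 1) : ℕ))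
      + K * (p ^ (N + 1)) ^ 2 := by
    intro j
    obtain ⟨K, hK⟩ := Polynomial.powAddExpansion (c * j : ℤ)
      (-(p ^ (N + 1) * (c * j / p ^ (N + 1) : ℕ))) (e + 1)
    refine ⟨K * ((c * j / p ^ (N + 1) : ℕ) : ℤ) ^ 2, ?_⟩
    have hdiv : ((c * j % p ^ (N + 1) : ℕ) : ℤ) + p ^ (N + 1) * (c * j / p ^ (N + 1) : ℕ) = c * j := by
      exact_mod_cast Nat.mod_add_div (c * j) (p ^ (N + 1))
    rw [eq_sub_of_add_eq hdiv, sub_eq_add_neg, hK, Nat.add_sub_cancel]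
    push_cast
    ring
  choose K hK using hterm
  refine ⟨-∑ j ∈ residuesPrimeTo p (N + 1), K j, ?_⟩
  have h : (∑ j ∈ residuesPrimeTo p (N + 1), ((c * j % p ^ (N + 1) : ℕ) : ℤ) ^ (e + 1)) =
      ∑ j ∈ residuesPrimeTo p (N + 1), (j : ℤ) ^ (e + 1) := by
    exact_mod_cast sum_residuesPrimeTo_mul_mod hp hc N (e + 1)
  rw [Finset.sum_congr rfl fun j _ => hK j, Finset.sum_add_distrib, Finset.sum_sub_distrib,
    ← Finset.sum_mul] at h
  have h1 : ∑ j ∈ residuesPrimeTo p (N + 1), (c * j : ℤ) ^ (e + 1) =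
      c ^ (e + 1) * ∑ j ∈ residuesPrimeTo p (N + 1), (j : ℤ) ^ (e + 1) := by
    rw [Finset.mul_sum]
    exact Finset.sum_congr rfl fun j _ => mul_pow _ _ _
  have h2 : ∑ j ∈ residuesPrimeTo p (N + 1), ((e : ℤ) + 1) * (c * j : ℤ) ^ e *
      (p ^ (N + 1) * (c * j / p ^ (N + 1) : ℕ)) =
      (e + 1) * p ^ (N + 1) * voronoiSum p c (N + 1) e := by
    rw [voronoiSum, Nat.cast_sum, Finset.mul_sum]
    refine Finset.sum_congr rfl fun j _ => ?_
    push_cast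
    ring
  rw [h1, h2] at h
  linear_combination h

theorem sum_residuesPrimeTo_pow {p : ℕ} (hp : p.Prime) (N n : ℕ) :
    ∑ j ∈ residuesPrimeTo p (N + 1), (j : ℚ) ^ n =
      ∑ j ∈ Finset.range (p ^ (N + 1)), (j : ℚ) ^ n -
        p ^ n * ∑ j ∈ Finset.range (p ^ N), (j : ℚ) ^ n := by
  have himg : (Finset.range (p ^ (N + 1))).filter (fun j => p ∣ j) =
      (Finset.range (p ^ N)).image (p * ·) := by
    ext j
    simp only [Finset.mem_filter, Finset.mem_range, Finset.mem_image]
    constructor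
    · rintro ⟨h, m, rfl⟩
      rw [pow_succ'] at h
      exact ⟨m, lt_of_mul_lt_mul_left h (Nat.zero_le p), rfl⟩
    · rintro ⟨m, h, rfl⟩
      rw [pow_succ']
      exact ⟨Nat.mul_lt_mul_of_pos_left h hp.pos, dvd_mul_right p m⟩
  have h := Finset.sum_filter_add_sum_filter_not (Finset.range (p ^ (N + 1))) (fun j => p ∣ j)
    (fun j : ℕ => (j : ℚ) ^ n)
  rw [himg, Finset.sum_image fun a _ b _ h => Nat.eq_of_mul_eq_mul_left hp.pos h] at h
  simp only [Nat.cast_mul, mul_pow] at h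
  rw [residuesPrimeTo, ← h, Finset.mul_sum, add_sub_cancel_left]

variable {p : ℕ} [Fact p.Prime]

theorem tendsto_natCast_prime_pow : Tendsto (fun N : ℕ => ((p : ℚ_[p]) ^ N)) atTop (𝓝 0) :=
  tendsto_pow_atTop_nhds_zero_of_norm_lt_one Padic.norm_p_lt_one

/-- By Faulhaber's formula the power sum is a polynomial in `p ^ N` without constant term and with
linear coefficient `bernoulli n`. -/
theorem tendsto_sum_range_pow_div (n : ℕ) :
    Tendsto (fun N : ℕ => ((∑ j ∈ Finset.range (p ^ N), (j : ℚ) ^ n : ℚ) : ℚ_[p]) / (p : ℚ_[p]) ^ N)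
      atTop (𝓝 ((bernoulli n : ℚ) : ℚ_[p])) := by
  have hp0 : (p : ℚ_[p]) ≠ 0 := Nat.cast_ne_zero.mpr (Fact.out : p.Prime).ne_zero
  have hfun : ∀ N : ℕ,
      ((∑ j ∈ Finset.range (p ^ N), (j : ℚ) ^ n : ℚ) : ℚ_[p]) / (p : ℚ_[p]) ^ N =
      ∑ i ∈ Finset.range (n + 1), ((bernoulli i * ((n + 1).choose i : ℕ) / (n + 1) : ℚ) : ℚ_[p]) *
        ((p : ℚ_[p]) ^ N) ^ (n - i) := by
    intro N
    rw [sum_range_pow, Rat.cast_sum, Finset.sum_div]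
    refine Finset.sum_congr rfl fun i hi => ?_
    have hi := Finset.mem_range.mp hi
    rw [show n + 1 - i = (n - i) + 1 by omega]
    push_cast
    rw [pow_succ ((p : ℚ_[p]) ^ N) (n - i)]
    have := pow_ne_zero N hp0
    field_simp
  simp only [hfun]
  have hlim : Tendsto (fun N : ℕ => ∑ i ∈ Finset.range (n + 1),
      ((bernoulli i * ((n + 1).choose i : ℕ) / (n + 1) : ℚ) : ℚ_[p]) * ((p : ℚ_[p]) ^ N) ^ (n - i))
      atTop (𝓝 (∑ i ∈ Finset.range (n + 1),
      ((bernoulli i * ((n + 1).choose i : ℕ) / (n + 1) : ℚ) : ℚ_[p]) * 0 ^ (n - i))) :=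
    tendsto_finsetSum _ fun i _ => (tendsto_natCast_prime_pow.pow _).const_mul _
  convert hlim using 2
  rw [Finset.sum_range_succ, Finset.sum_eq_zero fun i hi => ?_]
  · rw [Nat.choose_succ_self_right, Nat.sub_self, pow_zero, mul_one, zero_add]
    push_cast
    rw [mul_div_cancel_right₀]
    exact_mod_cast Nat.succ_ne_zero n
  · have hi := Finset.mem_range.mp hi
    rw [zero_pow (by omega), mul_zero]

/-- The `p`-deprived Bernoulli quotient `(1 - p ^ e) B_{e + 1} / (e + 1)`. -/
def bernoulliQuotient (p e : ℕ) : ℚ := (1 - (p : ℚ) ^ e) * bernoulli (e + 1) / (e + 1)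

theorem tendsto_voronoiSum {c : ℕ} (hc : ¬ p ∣ c) (e : ℕ) :
    Tendsto (fun N : ℕ => (voronoiSum p c (N + 1) e : ℚ_[p])) atTop
      (𝓝 (((c : ℚ_[p]) ^ (e + 1) - 1) * (bernoulliQuotient p e : ℚ_[p]))) := by
  have hp : p.Prime := Fact.out
  have hp0 : (p : ℚ_[p]) ≠ 0 := Nat.cast_ne_zero.mpr hp.ne_zero
  have he : ((e : ℚ_[p]) + 1) ≠ 0 := by exact_mod_cast Nat.succ_ne_zero e
  choose K hK using exists_voronoi hp hc (e := e)
  have hsum : Tendsto (fun N : ℕ => ((∑ j ∈ residuesPrimeTo p (N + 1), (j : ℚ) ^ (e + 1) : ℚ) : ℚ_[p])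
      / (p : ℚ_[p]) ^ (N + 1)) atTop (𝓝 ((1 - (p : ℚ_[p]) ^ e) * (bernoulli (e + 1) : ℚ))) := by
    have h := tendsto_sum_range_pow_div (p := p) (e + 1)
    convert ((tendsto_add_atTop_iff_nat 1).mpr h).sub (h.const_mul ((p : ℚ_[p]) ^ e)) using 2 with N
    · rw [sum_residuesPrimeTo_pow hp]
      push_cast
      field_simp
      ring
    · ring
  -- `K N` is an integer, so the Voronoi error stays small after division by `p ^ (N + 1)`.
  have herr : Tendsto (fun N : ℕ => (K N : ℚ_[p]) * (p : ℚ_[p]) ^ (N + 1)) atTop (𝓝 0) := by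
    refine squeeze_zero_norm (fun N => ?_) (tendsto_zero_iff_norm_tendsto_zero.mp
      ((tendsto_add_atTop_iff_nat 1).mpr (tendsto_natCast_prime_pow (p := p))))
    rw [norm_mul]
    exact mul_le_of_le_one_left (norm_nonneg _) (Padic.norm_int_le_one _)
  have hlim := ((hsum.const_mul ((c : ℚ_[p]) ^ (e + 1) - 1)).sub herr).div_const ((e : ℚ_[p]) + 1)
  convert hlim using 2 with N
  · have h : (((c : ℚ_[p]) ^ (e + 1) - 1) * ∑ j ∈ residuesPrimeTo p (N + 1), (j : ℚ_[p]) ^ (e + 1)) =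
      (e + 1) * p ^ (N + 1) * voronoiSum p c (N + 1) e + K N * (p ^ (N + 1)) ^ 2 := by
      exact_mod_cast congrArg (Int.cast : ℤ → ℚ_[p]) (hK N)
    rw [eq_div_iff he]
    push_cast
    rw [← mul_div_assoc, h]
    field_simp
    ring
  · rw [bernoulliQuotient]
    push_cast
    rw [sub_zero]
    ring

/-! ### Kummer's congruences -/

theorem pow_modEq_pow_add {a : ℕ} (ha : ¬ p ∣ a) (e l d : ℕ) :
    a ^ e ≡ a ^ (e + (p - 1) * p ^ l * d) [MOD p ^ (l + 1)] := by
  have hp : p.Prime := Fact.out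
  have h := Nat.ModEq.pow_totient (x := a) (n := p ^ (l + 1))
    (Nat.Coprime.pow_right _ (((Nat.Prime.coprime_iff_not_dvd hp).mpr ha).symm))
  rw [Nat.totient_prime_pow_succ hp, mul_comm] at h
  have h2 := (h.pow d).mul_left (a ^ e)
  rw [one_pow, mul_one, ← pow_mul, ← pow_add] at h2
  exact h2.symm

/-- The floor factors do not involve `e`; Euler's theorem handles the powers. -/
theorem voronoiSum_modEq {c : ℕ} (hc : ¬ p ∣ c) (N e l d : ℕ) :
    voronoiSum p c N e ≡ voronoiSum p c N (e + (p - 1) * p ^ l * d) [MOD p ^ (l + 1)] := by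
  have hp : p.Prime := Fact.out
  refine Nat.ModEq.sum fun j hj => (pow_modEq_pow_add ?_ e l d).mul_left _
  have hj := (Finset.mem_filter.mp hj).2
  exact fun h => ((hp.dvd_mul).mp h).elim hc hj

theorem norm_natCast_sub_le_of_modEq {a b n : ℕ} (h : a ≡ b [MOD p ^ n]) :
    ‖(a : ℚ_[p]) - b‖ ≤ (p : ℝ) ^ (-n : ℤ) := by
  have h' : ((p ^ n : ℕ) : ℤ) ∣ (a : ℤ) - b := (Nat.modEq_iff_dvd.mp h.symm)
  have := (Padic.norm_int_le_pow_iff_dvd (p := p) ((a : ℤ) - b) n).mpr h'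
  exact_mod_cast this

/-- Makes the factor `c ^ (e + 1) - 1` a `p`-adic unit, so it can be cancelled. -/
theorem exists_primitive_root_natCast (p : ℕ) [Fact p.Prime] :
    ∃ c : ℕ, ¬ p ∣ c ∧ ∀ n : ℕ, ¬ (p - 1) ∣ n → ¬ c ^ n ≡ 1 [MOD p] := by
  obtain ⟨g, hg⟩ := IsCyclic.exists_generator (α := (ZMod p)ˣ)
  have hord : orderOf g = p - 1 := by
    rw [orderOf_eq_card_of_forall_mem_zpowers hg, Nat.card_eq_fintype_card, ZMod.card_units]
  refine ⟨(g : ZMod p).val, fun h => ?_, fun n hn h => hn ?_⟩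
  · have := (ZMod.natCast_eq_zero_iff _ p).mpr h
    rw [ZMod.natCast_zmod_val] at this
    exact g.ne_zero this
  · rw [← hord, orderOf_dvd_iff_pow_eq_one]
    have := (ZMod.natCast_eq_natCast_iff _ _ p).mpr h
    rw [Nat.cast_pow, ZMod.natCast_zmod_val, Nat.cast_one] at this
    exact Units.ext (by rw [Units.val_pow_eq_pow_val, this, Units.val_one])

theorem norm_natCast_pow_sub_one {c n : ℕ} (h : ¬ c ^ n ≡ 1 [MOD p]) :
    ‖(c : ℚ_[p]) ^ n - 1‖ = 1 := by
  have hle : ‖(((c : ℤ) ^ n - 1 : ℤ) : ℚ_[p])‖ ≤ 1 := Padic.norm_int_le_one _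
  have hlt : ¬ ‖(((c : ℤ) ^ n - 1 : ℤ) : ℚ_[p])‖ < 1 := by
    rw [Padic.norm_intCast_lt_one_iff]
    intro hd
    exact h ((Nat.modEq_iff_dvd.mpr (by exact_mod_cast hd)).symm)
  have := le_antisymm hle (not_lt.mp hlt)
  exact_mod_cast this

/-- **Kummer's congruences.** -/
theorem norm_bernoulliQuotient_sub_le {e : ℕ} (he : ¬ (p - 1) ∣ e + 1) (l d : ℕ) :
    ‖(bernoulliQuotient p e : ℚ_[p]) - bernoulliQuotient p (e + (p - 1) * p ^ l * d)‖ ≤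
      (p : ℝ) ^ (-(l + 1 : ℕ) : ℤ) := by
  obtain ⟨c, hc, hroot⟩ := exists_primitive_root_natCast p
  set e' := e + (p - 1) * p ^ l * d with he'
  have hdvd : ¬ (p - 1) ∣ e' + 1 := by
    rw [he', show e + (p - 1) * p ^ l * d + 1 = (p - 1) * (p ^ l * d) + (e + 1) by ring,
      Nat.dvd_add_right (dvd_mul_right _ _)]
    exact he
  have h1 := norm_natCast_pow_sub_one (hroot _ he)
  have h2 := norm_natCast_pow_sub_one (hroot _ hdvd)
  have t1 := tendsto_voronoiSum hc e
  have t2 := tendsto_voronoiSum hc e'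
  -- The quotient is `p`-integral, being up to a unit a limit of integers.
  have hint : ‖(bernoulliQuotient p e' : ℚ_[p])‖ ≤ 1 := by
    have := le_of_tendsto t2.norm (Eventually.of_forall fun N => by
      exact_mod_cast Padic.norm_int_le_one (voronoiSum p c (N + 1) e' : ℤ))
    rwa [norm_mul, h2, one_mul] at this
  have hL := le_of_tendsto (t1.sub t2).norm
    (Eventually.of_forall fun N => norm_natCast_sub_le_of_modEq (voronoiSum_modEq hc (N + 1) e l d))
  have hcc : ‖(c : ℚ_[p]) ^ (e + 1) - (c : ℚ_[p]) ^ (e' + 1)‖ ≤ (p : ℝ) ^ (-(l + 1 : ℕ) : ℤ) := by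
    have := norm_natCast_sub_le_of_modEq (pow_modEq_pow_add hc (e + 1) l d)
    rw [show e + 1 + (p - 1) * p ^ l * d = e' + 1 by omega] at this
    exact_mod_cast this
  set y := (bernoulliQuotient p e : ℚ_[p])
  set y' := (bernoulliQuotient p e' : ℚ_[p])
  have key : ((c : ℚ_[p]) ^ (e + 1) - 1) * (y - y') =
      (((c : ℚ_[p]) ^ (e + 1) - 1) * y - ((c : ℚ_[p]) ^ (e' + 1) - 1) * y') -
        ((c : ℚ_[p]) ^ (e + 1) - (c : ℚ_[p]) ^ (e' + 1)) * y' := by ring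
  calc ‖y - y'‖ = ‖((c : ℚ_[p]) ^ (e + 1) - 1) * (y - y')‖ := by rw [norm_mul, h1, one_mul]
    _ ≤ _ := by
      rw [key, sub_eq_add_neg]
      refine (Padic.nonarchimedean _ _).trans (max_le hL ?_)
      rw [norm_neg, norm_mul]
      exact (mul_le_of_le_one_right (norm_nonneg _) hint).trans hcc

/-! ### `p`-adic interpolation -/

/-- A `p`-adically nonexpanding function on `ℕ` extends continuously to `ℤ_[p]`. -/
theorem exists_continuous_extension {h : ℕ → ℚ_[p]}
    (hh : ∀ t u : ℕ, ‖h t - h u‖ ≤ ‖(t : ℤ_[p]) - u‖) :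
    ∃ F : ℤ_[p] → ℚ_[p], Continuous F ∧ ∀ t : ℕ, F t = h t := by
  have hd : Dense (Set.range (Nat.cast : ℕ → ℤ_[p])) := PadicInt.denseRange_natCast
  let f : Set.range (Nat.cast : ℕ → ℤ_[p]) → ℚ_[p] := fun x => h x.2.choose
  have hf : LipschitzWith 1 f := LipschitzWith.of_dist_le_mul fun x y => by
    rw [NNReal.coe_one, one_mul, Subtype.dist_eq, dist_eq_norm, dist_eq_norm]
    have := hh x.2.choose y.2.choose
    rwa [x.2.choose_spec, y.2.choose_spec] at this
  refine ⟨hd.extend f, (hd.uniformContinuous_extend hf.uniformContinuous).continuous, fun t => ?_⟩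
  have h1 := hd.extend_of_ind hf.uniformContinuous ⟨(t : ℤ_[p]), t, rfl⟩
  refine h1.trans (congrArg h (Nat.cast_injective (R := ℤ_[p]) ?_))
  exact (⟨t, rfl⟩ : ∃ u : ℕ, (u : ℤ_[p]) = t).choose_spec

/-- The Bernoulli quotients at the exponents `i (1 + (p - 1) t)` are interpolated by a continuous
function of `t`. -/
theorem exists_continuous_bernoulliQuotient {i : ℕ} (hi : ¬ (p - 1) ∣ i + 1) :
    ∃ F : ℤ_[p] → ℚ_[p], Continuous F ∧
      ∀ t : ℕ, F t = (bernoulliQuotient p (i * (1 + (p - 1) * t)) : ℚ_[p]) := by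
  refine exists_continuous_extension
    (h := fun t => (bernoulliQuotient p (i * (1 + (p - 1) * t)) : ℚ_[p])) fun t u => ?_
  wlog htu : t ≤ u generalizing t u
  · rw [norm_sub_rev, norm_sub_rev (t : ℤ_[p])]
    exact this u t (by omega)
  obtain ⟨v, rfl⟩ := Nat.exists_eq_add_of_le htu
  rcases eq_or_ne v 0 with rfl | hv
  · simp
  obtain ⟨l, d, hd, rfl⟩ := Nat.exists_eq_pow_mul_and_not_dvd hv p (Fact.out : p.Prime).ne_one
  have hnd : ¬ (p - 1) ∣ i * (1 + (p - 1) * t) + 1 := by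
    rw [show i * (1 + (p - 1) * t) + 1 = (p - 1) * (i * t) + (i + 1) by ring,
      Nat.dvd_add_right (dvd_mul_right _ _)]
    exact hi
  -- The exponents differ by `(p - 1) p ^ l (i d)`; Kummer gives one power of `p` more than needed.
  have h := norm_bernoulliQuotient_sub_le hnd l (i * d)
  rw [show i * (1 + (p - 1) * t) + (p - 1) * p ^ l * (i * d) =
    i * (1 + (p - 1) * (t + p ^ l * d)) by ring] at h
  refine h.trans ?_
  have hnorm : ‖(t : ℤ_[p]) - ((t + p ^ l * d : ℕ) : ℤ_[p])‖ = (p : ℝ) ^ (-l : ℤ) := by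
    push_cast
    rw [sub_add_cancel_left, norm_neg, norm_mul, PadicInt.norm_p_pow]
    rw [PadicInt.norm_natCast_eq_one_iff.mpr
      ((Nat.Prime.coprime_iff_not_dvd (Fact.out : p.Prime)).mpr hd), mul_one]
  rw [hnorm]
  exact zpow_le_zpow_right₀ (by exact_mod_cast (Fact.out : p.Prime).one_le) (by push_cast; omega)

end PartitionZeta

namespace PartitionZeta

/-! ### Special values, density and conclusion -/

theorem zetaPrimeTo_neg_natCast (p : ℕ) {e : ℕ} (he : e ≠ 0) :
    zetaPrimeTo p (-(e : ℂ)) = ((-bernoulliQuotient p e : ℚ) : ℂ) := by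
  rw [zetaPrimeTo, riemannZeta_neg_nat_eq_bernoulli', neg_neg, Complex.cpow_natCast,
    bernoulliQuotient, bernoulli_eq_bernoulli'_of_ne_one (by omega)]
  push_cast
  ring

theorem continuous_completeHomogeneous {X K : Type*} [TopologicalSpace X] [Field K]
    [TopologicalSpace K] [IsTopologicalRing K] {P : ℕ → X → K} (hP : ∀ i, Continuous (P i))
    (k : ℕ) : Continuous fun s => completeHomogeneous (fun i => P i s) k := by
  induction k using Nat.strong_induction_on with
  | _ k ih =>
    cases k with
    | zero => simpa only [completeHomogeneous_zero] using continuous_const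
    | succ k =>
      simp only [completeHomogeneous_succ, div_eq_mul_inv]
      exact (continuous_finsetSum _ fun i _ =>
        (hP (i + 1)).mul (ih (k - i) (by omega))).mul continuous_const

theorem hasPositiveProportion_of_progression {A : Set ℤ} {d : ℕ} (hd : 0 < d)
    (hA : ∀ t : ℕ, -(1 + (d : ℤ) * t) ∈ A) : HasPositiveProportion A := by
  -- At least `N / d` terms lie in the window, and `2 N + 1 ≤ 4 N` for `N ≥ 1`.
  refine ⟨1 / (4 * d), by positivity, Filter.eventually_atTop.mpr ⟨1, fun N hN => ?_⟩⟩
  set B := A ∩ Set.Icc (-(N : ℤ)) (N : ℤ)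
  have hfin : B.Finite := (Set.finite_Icc _ _).inter_of_right _
  let g : ℕ → ℤ := fun t => -(1 + (d : ℤ) * t)
  have hg : Function.Injective g := fun a b h => by
    have hd' : (d : ℤ) ≠ 0 := by omega
    have h : -(1 + (d : ℤ) * a) = -(1 + (d : ℤ) * b) := h
    have := mul_left_cancel₀ hd' (add_left_cancel (neg_injective h))
    exact_mod_cast this
  have hsub : (((Finset.range ((N - 1) / d + 1)).image g : Finset ℤ) : Set ℤ) ⊆ B := by
    intro s hs
    obtain ⟨t, ht, rfl⟩ := Finset.mem_image.mp (Finset.mem_coe.mp hs)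
    have h1 : t ≤ (N - 1) / d := Nat.lt_succ_iff.mp (Finset.mem_range.mp ht)
    have h2 : t * d ≤ N - 1 := (Nat.le_div_iff_mul_le hd).mp h1
    have h3 : (d : ℤ) * t + 1 ≤ N := by
      have : t * d + 1 ≤ N := by omega
      rw [mul_comm]
      exact_mod_cast this
    have h4 : 0 ≤ (d : ℤ) * t := by positivity
    refine ⟨hA t, ?_, ?_⟩ <;> simp only [g] <;> omega
  have hcard := Set.ncard_le_ncard hsub hfin
  rw [Set.ncard_coe_finset, Finset.card_image_of_injective _ hg, Finset.card_range] at hcard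
  have hlt : N ≤ d * ((N - 1) / d + 1) := by
    have := Nat.lt_mul_div_succ (N - 1) hd
    omega
  have hle : (N : ℝ) ≤ d * (B.ncard : ℝ) := by
    exact_mod_cast hlt.trans (Nat.mul_le_mul_left d hcard)
  have hN' : (1 : ℝ) ≤ N := by exact_mod_cast hN
  have hd' : (0 : ℝ) < d := by exact_mod_cast hd
  rw [one_div_mul_eq_div, div_le_iff₀ (by positivity)]
  linarith

/-- The `p`-adic interpolation of the partition zeta function along `m ≡ 2 (mod p - 1)`. -/
theorem exists_continuous_agreeAt {k p : ℕ} [Fact p.Prime] (hp : k + 3 ≤ p) :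
    ∃ f : ℤ_[p] → ℚ_[p], Continuous f ∧
      ∀ t : ℕ, AgreeAt (partitionZeta p k) f (-(1 + ((p - 1 : ℕ) : ℤ) * t)) := by
  have hF : ∀ i : ℕ, ∃ F : ℤ_[p] → ℚ_[p], Continuous F ∧ (1 ≤ i → i ≤ k →
      ∀ t : ℕ, F t = (bernoulliQuotient p (i * (1 + (p - 1) * t)) : ℚ_[p])) := by
    intro i
    by_cases hi : i ≤ k
    · have hnd : ¬ (p - 1) ∣ i + 1 := fun h => by
        have := Nat.le_of_dvd (Nat.succ_pos i) h
        omega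
      obtain ⟨F, hc, hF⟩ := exists_continuous_bernoulliQuotient hnd
      exact ⟨F, hc, fun _ _ => hF⟩
    -- Only indices up to `k` enter the polynomial; the rest merely need to be continuous.
    · exact ⟨0, continuous_const, fun _ h => absurd h hi⟩
  choose F hcont hF using hF
  -- The inverse of `p - 1` recovers `t = -(s + 1) u` from `s = -(1 + (p - 1) t)`.
  obtain ⟨u, hu⟩ : ∃ u : ℤ_[p], ((p - 1 : ℕ) : ℤ_[p]) * u = 1 := by
    refine IsUnit.exists_right_inv (PadicInt.isUnit_iff.mpr
      (PadicInt.norm_natCast_eq_one_iff.mpr ?_))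
    refine (Nat.Prime.coprime_iff_not_dvd Fact.out).mpr fun h => ?_
    have := Nat.le_of_dvd (by omega) h
    omega
  refine ⟨fun s => completeHomogeneous (fun i => -F i (-(s + 1) * u)) k,
    continuous_completeHomogeneous (P := fun i s => -F i (-(s + 1) * u))
      (fun i => ((hcont i).comp (by fun_prop)).neg) k, fun t => ?_⟩
  refine ⟨completeHomogeneous (fun i => -bernoulliQuotient p (i * (1 + (p - 1) * t))) k, ?_, ?_⟩
  · rw [partitionZeta, ← Rat.coe_castHom (α := ℂ), map_completeHomogeneous]
    refine completeHomogeneous_congr fun i hi _ => ?_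
    have harg : (i : ℂ) * ((-(1 + ((p - 1 : ℕ) : ℤ) * t) : ℤ) : ℂ) =
        -((i * (1 + (p - 1) * t) : ℕ) : ℂ) := by
      push_cast
      ring
    rw [harg, zetaPrimeTo_neg_natCast p (Nat.mul_ne_zero (by omega) (by omega)),
      Rat.coe_castHom]
  · rw [← Rat.coe_castHom (α := ℚ_[p]), map_completeHomogeneous]
    refine completeHomogeneous_congr fun i hi hik => ?_
    have harg : -(((-(1 + ((p - 1 : ℕ) : ℤ) * t) : ℤ) : ℤ_[p]) + 1) * u = (t : ℤ_[p]) := by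
      push_cast
      linear_combination (t : ℤ_[p]) * hu
    rw [harg, hF i hi hik t, Rat.coe_castHom, Rat.cast_neg]

end PartitionZeta

theorem mainTheorem12 (k p : ℕ) [Fact p.Prime] (hk : 1 ≤ k) (hp : k + 3 ≤ p) :
    (∃ Z : ℂ → ℂ, PartitionZeta.IsPartitionZeta p k Z) ∧
    ∀ Z : ℂ → ℂ, PartitionZeta.IsPartitionZeta p k Z →
      ∃ f : ℤ_[p] → ℚ_[p], Continuous f ∧
        (∀ m : ℕ, m ≡ 2 [MOD p - 1] → PartitionZeta.AgreeAt Z f (1 - (m : ℤ))) ∧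
        PartitionZeta.HasPositiveProportion {s : ℤ | PartitionZeta.AgreeAt Z f s} := by
  have hW := PartitionZeta.isPartitionZeta_partitionZeta (Fact.out : p.Prime).ne_zero k
  refine ⟨⟨_, hW⟩, fun Z hZ => ?_⟩
  obtain ⟨f, hf, hagree⟩ := PartitionZeta.exists_continuous_agreeAt (k := k) (p := p) hp
  have hZagree : ∀ t : ℕ, PartitionZeta.AgreeAt Z f (-(1 + ((p - 1 : ℕ) : ℤ) * t)) := by
    intro t
    obtain ⟨q, h1, h2⟩ := hagree t
    refine ⟨q, (hZ.eqOn hW fun r hr h => ?_).trans h1, h2⟩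
    have hr := (Finset.mem_Icc.mp hr).1
    have h' : (r : ℤ) * -(1 + ((p - 1 : ℕ) : ℤ) * t) = 1 := by exact_mod_cast h
    have : 0 ≤ (r : ℤ) * (1 + ((p - 1 : ℕ) : ℤ) * t) := by positivity
    linarith
  refine ⟨f, hf, fun m hm => ?_,
    PartitionZeta.hasPositiveProportion_of_progression (d := p - 1) (by omega) hZagree⟩
  -- Since `p - 1 ≥ 3`, neither `0` nor `1` is congruent to `2`.
  have hm2 : 2 ≤ m := by
    by_contra hlt
    have := hm.eq_of_lt_of_lt (by omega) (by omega)
    omega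
  obtain ⟨t, ht⟩ := (Nat.modEq_iff_dvd' hm2).mp hm.symm
  convert hZagree t using 1
  have : (m : ℤ) = 2 + ((p - 1 : ℕ) : ℤ) * t := by
    have : m = 2 + (p - 1) * t := by omega
    exact_mod_cast this
  omega
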